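/- Let $(\Omega,\mathcal F,\mathrm P)$ be an atomless probability space, let $p\in[1,\infty)$, and let $L^p=L^p(\Omega,\mathcal F,\mathrm P)$ (real-valued, modulo almost sure equality). Let $\rho:L^p\to\mathbb R$ be a law-invariant coherent risk measure, that is: $\rho(X_1)\le\rho(X_2)$ whenever $X_1\le X_2$ almost surely; $\rho(X+m)=\rho(X)+m$ for $m\in\mathbb R$ (cash additivity); $\rho(X_1+X_2)\le\rho(X_1)+\rho(X_2)$; $\rho(cX)=c\rho(X)$ for $c\ge 0$ (positive homogeneity); and $\rho(X)=\rho(Y)$ whenever $X$ and $Y$ have the same law. Let $\mathcal M(L^p)$ be the set of the laws of the elements of $L^p$, and for $\mu\in\mathcal M(L^p)$ put $\mathcal R_\rho(\mu):=\rho(X_\mu)$, where $X_\mu\in L^p$ is any element with law $\mu$. Let $g_\rho(t):=1-\rho(B_{1-t})$ for $t\in[0,1]$, where $B_{1-t}$ is any Bernoulli ($\{0,1\}$-valued) random variable with expectation $1-t$. For $\lambda\ge 0$ and probability measures $\mu_1,\mu_2$ on $\mathbb R$ with distribution functions $F_{\mu_1},F_{\mu_2}$ let $$d_{\phi_\lambda}(\mu_1,\mu_2):=\sup_{x\in\mathbb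 R}|F_{\mu_1}(x)-F_{\mu_2}(x)|\,(1+|x|^\lambda)\in[0,\infty],$$ and let $\mathcal M_1^\lambda$ be the set of all probability measures $\mu$ on $\mathbb R$ with $d_{\phi_\lambda}(\mu,\delta_0)<\infty$. Let $\mathcal N_{0,1}$ be the standard normal distribution. Assume that there are constants $L,\beta>0$ such that $1-g_\rho(t)\le L(1-t)^\beta$ for all $t\in[0,1]$. Then for every $\lambda>p$ with $\lambda\beta>1$ the following two conditions hold. (c) $\rho$ is cash additive and positively homogeneous, and $\mathcal M_1^\lambda\subset\mathcal M(L^p)$. (d) For each sequence $(\mathfrak m_n)_{n\in\mathbb N}$ in $\mathcal M_1^\lambda$ with $d_{\phi_\lambda}(\mathfrak m_n,\mathcal N_{0,1})\to 0$ there is a constant $C>0$ such that, with the above $\beta$, $$|\mathcal R_\rho(\mathfrak m_n)-\mathcal R_\rho(\mathcal N_{0,1})|\le C\,d_{\phi_\lambda}(\mathfrak m_n,\mathcal N_{0,1})^\beta\qquad\text{for all }n\in\mathbb N.$$ -/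

import Mathlib

open MeasureTheory ProbabilityTheory Filter Topology
open scoped ENNReal unitInterval

noncomputable section

namespace RiskMeasure

/-- A measure is atomless if every measurable set of positive measure contains a measurable subset
of strictly smaller positive measure. (This is a condition on sets; it is stronger than the
vanishing of the measure on singletons.) -/
def IsAtomless {Ω : Type*} [MeasurableSpace Ω] (P : Measure Ω) : Prop :=
  ∀ A : Set Ω, MeasurableSet A → 0 < P A →
    ∃ B : Set Ω, MeasurableSet B ∧ B ⊆ A ∧ 0 < P B ∧ P B < P A

section Functionals

variable {Ω : Type*} [MeasurableSpace Ω] {P : Measure Ω} {q : ℝ≥0∞}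

/-- The law of (the class of) a random variable. -/
def law (X : Lp ℝ q P) : Measure ℝ := P.map (X : Ω → ℝ)

/-- `X₁ ≤ X₂` is the almost sure order on `L^q`. -/
def IsMonotone (ρ : Lp ℝ q P → ℝ) : Prop :=
  ∀ X₁ X₂ : Lp ℝ q P, X₁ ≤ X₂ → ρ X₁ ≤ ρ X₂

def IsCashAdditive [IsFiniteMeasure P] (ρ : Lp ℝ q P → ℝ) : Prop :=
  ∀ (X : Lp ℝ q P) (m : ℝ), ρ (X + Lp.const q P m) = ρ X + m

def IsSubadditive (ρ : Lp ℝ q P → ℝ) : Prop :=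
  ∀ X₁ X₂ : Lp ℝ q P, ρ (X₁ + X₂) ≤ ρ X₁ + ρ X₂

def IsPosHomogeneous (ρ : Lp ℝ q P → ℝ) : Prop :=
  ∀ (X : Lp ℝ q P) (c : ℝ), 0 ≤ c → ρ (c • X) = c * ρ X

/-- A coherent risk measure on `L^q`. -/
structure IsCoherent [IsFiniteMeasure P] (ρ : Lp ℝ q P → ℝ) : Prop where
  monotone : IsMonotone ρ
  cashAdditive : IsCashAdditive ρ
  subadditive : IsSubadditive ρ
  posHomogeneous : IsPosHomogeneous ρ

def IsLawInvariant (ρ : Lp ℝ q P → ℝ) : Prop :=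
  ∀ X Y : Lp ℝ q P, law X = law Y → ρ X = ρ Y

/-- The set `𝓜(L^q)` of the laws of the elements of `L^q`. -/
def lawsOf (P : Measure Ω) (q : ℝ≥0∞) : Set (Measure ℝ) :=
  {μ | ∃ X : Lp ℝ q P, law X = μ}

open Classical in
/-- The statistical functional `𝓡_ρ` on `𝓜(L^q)`: the value of `ρ` at an element of `L^q` with
law `μ` (and `0` outside `𝓜(L^q)`). -/
def riskFunctional (ρ : Lp ℝ q P → ℝ) (μ : Measure ℝ) : ℝ :=
  if h : μ ∈ lawsOf P q then ρ h.choose else 0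

/-- For law-invariant `ρ`, the choice in the definition of `riskFunctional` does not matter. -/
theorem riskFunctional_law {ρ : Lp ℝ q P → ℝ} (hρ : IsLawInvariant ρ) (X : Lp ℝ q P) :
    riskFunctional ρ (law X) = ρ X := by
  have h : law X ∈ lawsOf P q := ⟨X, rfl⟩
  rw [riskFunctional, dif_pos h]
  exact hρ _ _ h.choose_spec

/-- `g_ρ(t) = 1 - ρ(B_{1-t})`, where `B_{1-t}` is a Bernoulli variable with expectation `1 - t`. -/
def gFun (ρ : Lp ℝ q P → ℝ) (t : I) : ℝ :=
  1 - riskFunctional ρ (bernoulliMeasure (1 : ℝ) 0 (unitInterval.symm t))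

end Functionals

/-- The weight function `φ_l(x) = 1 + |x|^l`. -/
def phi (l x : ℝ) : ℝ := 1 + |x| ^ l

/-- The nonuniform Kolmogorov distance, the supremum of `|F_μ(x) - F_ν(x)| φ_l(x)`, with values
in `[0, ∞]`. -/
def dKolmogorov (l : ℝ) (μ ν : Measure ℝ) : ℝ≥0∞ :=
  ⨆ x : ℝ, ENNReal.ofReal (|cdf μ x - cdf ν x| * phi l x)

/-- The set `𝓜₁^l` of all probability measures on `ℝ` at finite distance from `δ₀`. -/
def weightedLaws (l : ℝ) : Set (Measure ℝ) :=
  {μ | IsProbabilityMeasure μ ∧ dKolmogorov l μ (Measure.dirac 0) < ∞}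

section Conditions

variable {Ω : Type*} [MeasurableSpace Ω] {P : Measure Ω} {q : ℝ≥0∞}

/-- Condition (c): `ρ` is cash additive and positively homogeneous, and `𝓜₁^l ⊆ 𝓜(L^q)`. -/
structure ConditionC [IsFiniteMeasure P] (ρ : Lp ℝ q P → ℝ) (l : ℝ) : Prop where
  cashAdditive : IsCashAdditive ρ
  posHomogeneous : IsPosHomogeneous ρ
  subset : weightedLaws l ⊆ lawsOf P q

/-- Condition (d) with exponent `β`: along every sequence in `𝓜₁^l` which converges to the standard
normal law in the nonuniform Kolmogorov distance, the error of the risk functional is bounded by a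
constant times the `β`-th power of that distance. -/
def ConditionD (ρ : Lp ℝ q P → ℝ) (l β : ℝ) : Prop :=
  ∀ m : ℕ → Measure ℝ, (∀ n, m n ∈ weightedLaws l) →
    Tendsto (fun n => dKolmogorov l (m n) (gaussianReal 0 1)) atTop (𝓝 0) →
    ∃ C : ℝ, 0 < C ∧ ∀ n,
      |riskFunctional ρ (m n) - riskFunctional ρ (gaussianReal 0 1)| ≤
        C * (dKolmogorov l (m n) (gaussianReal 0 1)).toReal ^ β

end Conditions

end RiskMeasure

end

/-! Represent all laws at once as quantiles of one uniform variable (`IsAtomless.exists_coupling`).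
For the representatives X, Y of μ, ν, the event {Y ≤ t < X} has probability at most |F_μ(t) -
F_ν(t)| ≤ d / φ(t), where d is the weighted distance and φ the weight `phi l`. Since X - Y ≤ ∫ 1{Y ≤
t < X} dt, coherence suggests ρ(X) - ρ(Y) ≤ ∫ ρ(1{Y ≤ t < X}) dt. Law invariance and the bound on g
give ρ(1_A) ≤ L P(A)^β, so the right side is at most L d^β ∫ φ^(-β), which is finite because λβ > 1.
To avoid continuity of ρ, the integral is replaced by a Riemann sum of mesh 1/M on [-M, M]
(`sub_le_add_sum_crossing`), whose weights are bounded uniformly in M (`sum_grid_phi_rpow_neg_le`).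
The part outside [-M, M] is dominated by M^(1-r) W with W = |X|^r + |Y|^r and r > 1. As λ > p, r can
be chosen with W in L^p, so this error is the fixed number ρ(W) times a null sequence. Letting M → ∞
gives `IsCoherent.sub_le_of_crossing`. -/

namespace RiskMeasure

/-! ### Atomless spaces: intermediate values and a uniform variable. -/

section Atomless

variable {Ω : Type*} [MeasurableSpace Ω] {P : Measure Ω}

/-- Exhaustion: a nonempty class of sets closed under countable increasing unions contains a set
whose measure is not exceeded by that of any larger set of the class. -/
theorem exists_measureReal_maximal [IsFiniteMeasure P] (V : Set Ω → Prop) {E₀ : Set Ω} (h₀ : V E₀)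
    (hV : ∀ E : ℕ → Set Ω, Monotone E → (∀ n, V (E n)) → V (⋃ n, E n)) :
    ∃ E, V E ∧ ∀ F, V F → E ⊆ F → P.real F ≤ P.real E := by
  -- Greedy choice: E' realises at least half of the measure that any enlargement of E within the
  -- class could gain. The gains along the iteration tend to 0, so nothing can be gained beyond the
  -- union.
  have step : ∀ E : Set Ω, ∃ E', V E → (V E' ∧ E ⊆ E' ∧
      ∀ F, V F → E' ⊆ F → P.real F - P.real E ≤ 2 * (P.real E' - P.real E)) := by
    intro E
    by_cases hE : V E
    swap
    · exact ⟨E, fun h => absurd h hE⟩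
    set T : Set ℝ := {x | ∃ F, V F ∧ E ⊆ F ∧ P.real F = x} with hT
    have hbdd : BddAbove T := by
      refine ⟨P.real Set.univ, ?_⟩
      rintro x ⟨F, -, -, rfl⟩
      exact measureReal_mono (Set.subset_univ _)
    have hmem : P.real E ∈ T := ⟨E, hE, subset_rfl, rfl⟩
    rcases eq_or_lt_of_le (le_csSup hbdd hmem) with h | h
    · refine ⟨E, fun _ => ⟨hE, subset_rfl, fun F hF hEF => ?_⟩⟩
      have := le_csSup hbdd (⟨F, hF, hEF, rfl⟩ : P.real F ∈ T)
      linarith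
    · obtain ⟨x, ⟨E', hE', hEE', rfl⟩, hx⟩ :=
        exists_lt_of_lt_csSup ⟨_, hmem⟩ (show (P.real E + sSup T) / 2 < sSup T by linarith)
      refine ⟨E', fun _ => ⟨hE', hEE', fun F hF hEF => ?_⟩⟩
      have := le_csSup hbdd (⟨F, hF, hEE'.trans hEF, rfl⟩ : P.real F ∈ T)
      linarith
  choose next hnext using step
  let E : ℕ → Set Ω := fun n => Nat.rec E₀ (fun _ A => next A) n
  have hE : ∀ n, V (E n) := by
    intro n
    induction n with
    | zero => exact h₀
    | succ n ih => exact (hnext _ ih).1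
  have hmono : Monotone E := monotone_nat_of_le_succ fun n => (hnext _ (hE n)).2.1
  refine ⟨⋃ n, E n, hV E hmono hE, fun F hF hEF => ?_⟩
  have hlim : Tendsto (fun n => P.real (E n)) atTop (𝓝 (P.real (⋃ n, E n))) :=
    (ENNReal.tendsto_toReal (measure_ne_top _ _)).comp (tendsto_measure_iUnion_atTop hmono)
  have hle : ∀ n, P.real F - P.real (E n) ≤ 2 * (P.real (E (n + 1)) - P.real (E n)) := fun n =>
    (hnext _ (hE n)).2.2 F hF ((Set.subset_iUnion E (n + 1)).trans hEF)
  have := le_of_tendsto_of_tendsto' (tendsto_const_nhds.sub hlim)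
    ((((tendsto_add_atTop_iff_nat 1).2 hlim).sub hlim).const_mul 2) hle
  linarith

/-- A proper part and its complement cannot both exceed half of the measure, so halving can be
iterated. -/
theorem IsAtomless.exists_measureReal_pos_lt [IsFiniteMeasure P] (hP : IsAtomless P) {A : Set Ω}
    (hA : MeasurableSet A) (hpos : 0 < P.real A) {ε : ℝ} (hε : 0 < ε) :
    ∃ B, MeasurableSet B ∧ B ⊆ A ∧ 0 < P.real B ∧ P.real B < ε := by
  have half : ∀ A : Set Ω, MeasurableSet A → 0 < P.real A →
      ∃ B, MeasurableSet B ∧ B ⊆ A ∧ 0 < P.real B ∧ P.real B ≤ P.real A / 2 := by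
    intro A hA hpos
    obtain ⟨B, hB, hBA, h0, h1⟩ := hP A hA (ENNReal.toReal_pos_iff.1 hpos).1
    have h0' : 0 < P.real B := ENNReal.toReal_pos h0.ne' (measure_ne_top _ _)
    have h1' : P.real B < P.real A :=
      (ENNReal.toReal_lt_toReal (measure_ne_top _ _) (measure_ne_top _ _)).2 h1
    rcases le_total (P.real B) (P.real A / 2) with h | h
    · exact ⟨B, hB, hBA, h0', h⟩
    · have := measureReal_sdiff (μ := P) hBA hB
      exact ⟨A \ B, hA.diff hB, Set.sdiff_subset, by linarith, by linarith⟩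
  have iter : ∀ n : ℕ, ∃ B, MeasurableSet B ∧ B ⊆ A ∧ 0 < P.real B ∧
      P.real B ≤ P.real A * (1 / 2) ^ n := by
    intro n
    induction n with
    | zero => exact ⟨A, hA, subset_rfl, hpos, by simp⟩
    | succ n ih =>
      obtain ⟨B, hB, hBA, h0, h1⟩ := ih
      obtain ⟨C, hC, hCB, h2, h3⟩ := half B hB h0
      exact ⟨C, hC, hCB.trans hBA, h2, by rw [pow_succ]; linarith⟩
  obtain ⟨n, hn⟩ := exists_pow_lt_of_lt_one (div_pos hε hpos) (by norm_num : (1 / 2 : ℝ) < 1)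
  obtain ⟨B, hB, hBA, h0, h1⟩ := iter n
  rw [lt_div_iff₀ hpos] at hn
  exact ⟨B, hB, hBA, h0, by linarith⟩

/-- Sierpiński: an atomless finite measure takes all intermediate values. -/
theorem IsAtomless.exists_measureReal_eq [IsFiniteMeasure P] (hP : IsAtomless P) {A B : Set Ω}
    (hA : MeasurableSet A) (hB : MeasurableSet B) (hAB : A ⊆ B) {c : ℝ} (hAc : P.real A ≤ c)
    (hcB : c ≤ P.real B) :
    ∃ C, MeasurableSet C ∧ A ⊆ C ∧ C ⊆ B ∧ P.real C = c := by
  obtain ⟨E, ⟨hE, hAE, hEB, hEc⟩, hmax⟩ := exists_measureReal_maximal (P := P)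
    (fun C => MeasurableSet C ∧ A ⊆ C ∧ C ⊆ B ∧ P.real C ≤ c) ⟨hA, subset_rfl, hAB, hAc⟩ (by
      intro E hmono hE
      refine ⟨MeasurableSet.iUnion fun n => (hE n).1, (hE 0).2.1.trans (Set.subset_iUnion E 0),
        Set.iUnion_subset fun n => (hE n).2.2.1, ?_⟩
      exact le_of_tendsto' ((ENNReal.tendsto_toReal (measure_ne_top _ _)).comp
        (tendsto_measure_iUnion_atTop hmono)) fun n => (hE n).2.2.2)
  refine ⟨E, hE, hAE, hEB, le_antisymm hEc (not_lt.1 fun hlt => ?_)⟩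
  have hd := measureReal_sdiff (μ := P) hEB hE
  -- A piece smaller than the deficit c - P(E) could still be added to E, against maximality.
  obtain ⟨D, hD, hDE, h0, h1⟩ := hP.exists_measureReal_pos_lt (hB.diff hE) (by linarith)
    (sub_pos.2 hlt)
  have hU : P.real (E ∪ D) = P.real E + P.real D :=
    measureReal_union (Set.disjoint_left.2 fun x hx hxD => (hDE hxD).2 hx) hD
  have := hmax (E ∪ D) ⟨hE.union hD, hAE.trans Set.subset_union_left,
    Set.union_subset hEB (hDE.trans Set.sdiff_subset), by linarith⟩ Set.subset_union_left
  linarith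

/-- On an atomless probability space there is a dyadic filtration of sets
`S n k` of probability `k / 2 ^ n`. -/
theorem IsAtomless.exists_dyadic [IsProbabilityMeasure P] (hP : IsAtomless P) :
    ∃ S : ℕ → ℕ → Set Ω, (∀ n k, MeasurableSet (S n k)) ∧ (∀ n, Monotone (S n)) ∧
      (∀ n k, S (n + 1) (2 * k) = S n k) ∧ S 0 0 = ∅ ∧ S 0 1 = Set.univ ∧
      ∀ n k, k ≤ 2 ^ n → P.real (S n k) = k / 2 ^ n := by
  have hmid : ∀ A B : Set Ω, ∃ C, MeasurableSet A → MeasurableSet B → A ⊆ B →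
      (MeasurableSet C ∧ A ⊆ C ∧ C ⊆ B ∧ P.real C = (P.real A + P.real B) / 2) := by
    intro A B
    by_cases h : MeasurableSet A ∧ MeasurableSet B ∧ A ⊆ B
    · have := measureReal_mono (μ := P) h.2.2
      obtain ⟨C, hC⟩ := hP.exists_measureReal_eq h.1 h.2.1 h.2.2
        (c := (P.real A + P.real B) / 2) (by linarith) (by linarith)
      exact ⟨C, fun _ _ _ => hC⟩
    · exact ⟨∅, fun h1 h2 h3 => absurd ⟨h1, h2, h3⟩ h⟩
  choose mid hmid using hmid
  -- Even indices inherit the previous level and odd ones bisect between neighbours; indices past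
  -- the right end start from the whole space.
  let S : ℕ → ℕ → Set Ω := fun n => Nat.rec (fun k => if k = 0 then ∅ else Set.univ)
    (fun _ T k => if k % 2 = 0 then T (k / 2) else mid (T (k / 2)) (T (k / 2 + 1))) n
  have hS : ∀ n k, S (n + 1) k =
    if k % 2 = 0 then S n (k / 2) else mid (S n (k / 2)) (S n (k / 2 + 1)) := fun _ _ => rfl
  have heven : ∀ n k, S (n + 1) (2 * k) = S n k := fun n k => by simp [hS]
  have hodd : ∀ n k, S (n + 1) (2 * k + 1) = mid (S n k) (S n (k + 1)) := fun n k => by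
    rw [hS, if_neg (by omega), show (2 * k + 1) / 2 = k by omega]
  have hbase : ∀ n, (∀ k, MeasurableSet (S n k)) ∧ Monotone (S n) ∧
      ∀ k, k ≤ 2 ^ n → P.real (S n k) = k / 2 ^ n := by
    intro n
    induction n with
    | zero =>
      refine ⟨fun k => ?_, monotone_nat_of_le_succ fun k => ?_, fun k hk => ?_⟩
      · rcases k with _ | k <;> simp [S]
      · rcases k with _ | k <;> simp [S]
      · have : k = 0 ∨ k = 1 := by simp at hk; omega
        rcases this with rfl | rfl <;> simp [S]
    | succ n ih =>
      obtain ⟨ih1, ih2, ih3⟩ := ih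
      have hm := fun k => hmid _ _ (ih1 k) (ih1 (k + 1)) (ih2 (Nat.le_succ k))
      refine ⟨fun k => ?_, monotone_nat_of_le_succ fun k => ?_, fun k hk => ?_⟩
      · obtain ⟨j, rfl | rfl⟩ := Nat.even_or_odd' k
        · rw [heven]; exact ih1 j
        · rw [hodd]; exact (hm j).1
      · obtain ⟨j, rfl | rfl⟩ := Nat.even_or_odd' k
        · rw [heven, hodd]; exact (hm j).2.1
        · rw [hodd, show 2 * j + 1 + 1 = 2 * (j + 1) by ring, heven]; exact (hm j).2.2.1
      · obtain ⟨j, rfl | rfl⟩ := Nat.even_or_odd' k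
        · rw [heven, ih3 j (by rw [pow_succ] at hk; omega)]
          push_cast; rw [pow_succ]; field_simp
        · rw [hodd, (hm j).2.2.2, ih3 j (by rw [pow_succ] at hk; omega),
            ih3 (j + 1) (by rw [pow_succ] at hk; omega)]
          push_cast; rw [pow_succ]; field_simp; ring
  exact ⟨S, fun n k => (hbase n).1 k, fun n => (hbase n).2.1, heven, by simp [S], by simp [S],
    fun n k => (hbase n).2.2 k⟩

/-- An atomless probability space carries a random variable which is uniform on `[0, 1]`. -/
theorem IsAtomless.exists_uniform [IsProbabilityMeasure P] (hP : IsAtomless P) :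
    ∃ U : Ω → ℝ, Measurable U ∧ ∀ t : ℝ, 0 ≤ t → t ≤ 1 → P.real {ω | U ω ≤ t} = t := by
  obtain ⟨S, hmeas, hmono, heven, h00, h01, hreal⟩ := hP.exists_dyadic
  have hshift : ∀ m n k, S (n + m) (2 ^ m * k) = S n k := by
    intro m n k
    induction m with
    | zero => simp
    | succ m ih => rw [← add_assoc, pow_succ', mul_assoc, heven, ih]
  have hcomp : ∀ m j n k : ℕ, (j : ℝ) / 2 ^ m ≤ k / 2 ^ n → S m j ⊆ S n k := by
    intro m j n k h
    rw [← hshift n m j, ← hshift m n k, add_comm n m]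
    apply hmono
    rw [div_le_div_iff₀ (by positivity) (by positivity)] at h
    have h' : j * 2 ^ n ≤ k * 2 ^ m := by exact_mod_cast h
    linarith [mul_comm j (2 ^ n), mul_comm k (2 ^ m)]
  -- The uniform variable is the infimum of the dyadic levels whose set contains ω.
  let T : Ω → Set ℝ := fun ω => {x | ∃ n k : ℕ, x = k / 2 ^ n ∧ ω ∈ S n k}
  have hbdd : ∀ ω, BddBelow (T ω) := by
    refine fun ω => ⟨0, ?_⟩
    rintro x ⟨n, k, rfl, -⟩
    positivity
  have hne : ∀ ω, (T ω).Nonempty := fun ω => ⟨_, 0, 1, rfl, by simp [h01]⟩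
  have hlt : ∀ ω t, sInf (T ω) < t ↔ ∃ n k : ℕ, (k : ℝ) / 2 ^ n < t ∧ ω ∈ S n k := by
    intro ω t
    constructor
    · intro h
      obtain ⟨x, ⟨n, k, rfl, hω⟩, hx⟩ := exists_lt_of_csInf_lt (hne ω) h
      exact ⟨n, k, hx, hω⟩
    · rintro ⟨n, k, hx, hω⟩
      exact (csInf_le (hbdd ω) ⟨n, k, rfl, hω⟩).trans_lt hx
  refine ⟨fun ω => sInf (T ω), ?_, fun t ht0 ht1 => ?_⟩
  · refine measurable_of_Iio fun t => ?_
    have : (fun ω => sInf (T ω)) ⁻¹' Set.Iio t =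
        ⋃ (n : ℕ) (k : ℕ) (_ : (k : ℝ) / 2 ^ n < t), S n k := by
      ext ω
      simp [hlt]
    rw [this]
    exact MeasurableSet.iUnion fun n => MeasurableSet.iUnion fun k =>
      MeasurableSet.iUnion fun _ => hmeas n k
  · have hbound : ∀ n : ℕ, |P.real {ω | sInf (T ω) ≤ t} - t| ≤ (1 / 2) ^ n := by
      intro n
      set k := ⌊2 ^ n * t⌋₊ with hk
      have hk0 : (k : ℝ) ≤ 2 ^ n * t := Nat.floor_le (by positivity)
      have hk1 : 2 ^ n * t < k + 1 := Nat.lt_floor_add_one _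
      have hp : (0 : ℝ) < 2 ^ n := by positivity
      have hkn : k ≤ 2 ^ n := by
        have : (k : ℝ) ≤ 2 ^ n := hk0.trans (by nlinarith)
        exact_mod_cast this
      have e1 : (k : ℝ) / 2 ^ n ≤ t := by rw [div_le_iff₀ hp]; linarith
      have e2 : t < ((k + 1 : ℕ) : ℝ) / 2 ^ n := by rw [lt_div_iff₀ hp]; push_cast; linarith
      have e3 : ((k + 1 : ℕ) : ℝ) / 2 ^ n = k / 2 ^ n + (1 / 2) ^ n := by
        push_cast; rw [add_div, one_div_pow]
      have lower : P.real (S n k) ≤ P.real {ω | sInf (T ω) ≤ t} :=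
        measureReal_mono fun ω hω => (csInf_le (hbdd ω) ⟨n, k, rfl, hω⟩).trans e1
      have upper : P.real {ω | sInf (T ω) ≤ t} ≤ P.real (S n (k + 1)) := by
        refine measureReal_mono fun ω hω => ?_
        obtain ⟨m, j, hj, hωj⟩ := (hlt ω _).1 (lt_of_le_of_lt hω e2)
        exact hcomp m j n (k + 1) hj.le hωj
      rw [hreal n k hkn] at lower
      have upper' : P.real {ω | sInf (T ω) ≤ t} ≤ k / 2 ^ n + (1 / 2) ^ n := by
        -- For t = 1 the index k + 1 leaves the range where the measure is prescribed, and P ≤ 1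
        -- suffices.
        rcases hkn.lt_or_eq with h | h
        · rw [hreal n (k + 1) h, e3] at upper
          exact upper
        · have : (k : ℝ) / 2 ^ n = 1 := by rw [h]; push_cast; exact div_self hp.ne'
          rw [this]
          exact measureReal_le_one.trans (le_add_of_nonneg_right (by positivity))
      rw [e3] at e2
      rw [abs_le]
      constructor <;> linarith
    have h0 : Tendsto (fun n : ℕ => (1 / 2 : ℝ) ^ n) atTop (𝓝 0) :=
      tendsto_pow_atTop_nhds_zero_of_lt_one (by norm_num) (by norm_num)
    have := ge_of_tendsto' h0 hbound
    exact sub_eq_zero.1 (abs_nonpos_iff.1 this)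

end Atomless

/-! ### Quantile coupling. -/

section Coupling

variable {Ω : Type*} [MeasurableSpace Ω] {P : Measure Ω}

/-- A uniform random variable with values in the open unit interval. -/
theorem IsAtomless.exists_uniform_Ioo [IsProbabilityMeasure P] (hP : IsAtomless P) :
    ∃ U : Ω → ℝ, Measurable U ∧ (∀ ω, U ω ∈ Set.Ioo (0 : ℝ) 1) ∧
      ∀ t : ℝ, 0 ≤ t → t ≤ 1 → P.real {ω | U ω ≤ t} = t := by
  classical
  obtain ⟨U, hU, hUt⟩ := hP.exists_uniform
  have hle : ∀ t : ℝ, MeasurableSet {ω | U ω ≤ t} := fun t => measurableSet_le hU measurable_const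
  have h0 : P {ω | U ω ≤ 0} = 0 := by
    rw [← measureReal_eq_zero_iff]
    exact hUt 0 le_rfl zero_le_one
  have h1 : P {ω | 1 ≤ U ω} = 0 := by
    rw [← measureReal_eq_zero_iff]
    refine le_antisymm (le_of_forall_pos_le_add fun ε hε => ?_) measureReal_nonneg
    set t := max 0 (1 - ε)
    have ht : t < 1 := max_lt one_pos (by linarith)
    have hc := probReal_compl_eq_one_sub (μ := P) (hle t)
    rw [hUt t (le_max_left _ _) ht.le] at hc
    have hsub : P.real {ω | 1 ≤ U ω} ≤ P.real {ω | U ω ≤ t}ᶜ :=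
      measureReal_mono fun ω (hω : 1 ≤ U ω) => not_le.2 (ht.trans_le hω)
    have := le_max_right 0 (1 - ε)
    linarith
  have hA : MeasurableSet (U ⁻¹' Set.Ioo (0 : ℝ) 1) := hU measurableSet_Ioo
  refine ⟨fun ω => if ω ∈ U ⁻¹' Set.Ioo (0 : ℝ) 1 then U ω else 1 / 2,
    Measurable.ite hA hU measurable_const, fun ω => ?_, fun t ht0 ht1 => ?_⟩
  · dsimp only
    split_ifs with h
    · exact h
    · norm_num
  · refine Eq.trans ?_ (hUt t ht0 ht1)
    refine measureReal_congr (Filter.eventuallyEq_set.2 ?_)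
    have h0' : ∀ᵐ ω ∂P, ¬ U ω ≤ 0 := by rw [ae_iff]; simpa using h0
    have h1' : ∀ᵐ ω ∂P, ¬ 1 ≤ U ω := by rw [ae_iff]; simpa using h1
    filter_upwards [h0', h1'] with ω hω0 hω1
    have : ω ∈ U ⁻¹' Set.Ioo (0 : ℝ) 1 := ⟨not_le.1 hω0, not_le.1 hω1⟩
    change (if ω ∈ U ⁻¹' Set.Ioo (0 : ℝ) 1 then U ω else 1 / 2) ≤ t ↔ U ω ≤ t
    rw [if_pos this]

/-- The (lower) quantile function of a law on the real line. -/
noncomputable def lowerQuantile (μ : Measure ℝ) (u : ℝ) : ℝ := sInf {x | u ≤ cdf μ x}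

/-- Right-continuity of the distribution function makes the infimum attained; 0 < u < 1 makes it an
infimum of a nonempty set bounded below. -/
theorem lowerQuantile_le_iff (μ : Measure ℝ) {u : ℝ} (hu : u ∈ Set.Ioo (0 : ℝ) 1) (x : ℝ) :
    lowerQuantile μ u ≤ x ↔ u ≤ cdf μ x := by
  obtain ⟨a, ha⟩ := ((tendsto_cdf_atBot μ).eventually_lt_const hu.1).exists
  obtain ⟨b, hb⟩ := ((tendsto_cdf_atTop μ).eventually_const_lt hu.2).exists
  have hne : {x | u ≤ cdf μ x}.Nonempty := ⟨b, hb.le⟩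
  have hbdd : BddBelow {x | u ≤ cdf μ x} :=
    ⟨a, fun y hy => le_of_not_gt fun h => absurd ((monotone_cdf μ) h.le) (not_le.2 (ha.trans_le hy))⟩
  refine ⟨fun h => ?_, fun h => csInf_le hbdd h⟩
  have hright : ∀ y, x < y → u ≤ cdf μ y := by
    intro y hy
    obtain ⟨z, hz, hzy⟩ := exists_lt_of_csInf_lt hne (h.trans_lt hy)
    exact le_trans hz (monotone_cdf μ hzy.le)
  have hcont : Tendsto (cdf μ) (𝓝[>] x) (𝓝 (cdf μ x)) :=
    ((cdf μ).right_continuous x).tendsto.mono_left (nhdsWithin_mono _ Set.Ioi_subset_Ici_self)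
  exact ge_of_tendsto hcont (eventually_nhdsWithin_of_forall fun y hy => hright y hy)

/-- Comonotone coupling: on an atomless probability space all laws on the real line can be
represented simultaneously, in such a way that differences of distribution functions are
probabilities of level crossings. -/
theorem IsAtomless.exists_coupling [IsProbabilityMeasure P] (hP : IsAtomless P) :
    ∃ Q : Measure ℝ → Ω → ℝ,
      (∀ μ, IsProbabilityMeasure μ → Measurable (Q μ) ∧ P.map (Q μ) = μ) ∧
      ∀ μ ν, IsProbabilityMeasure μ → IsProbabilityMeasure ν → ∀ x,
        P.real {ω | Q ν ω ≤ x ∧ x < Q μ ω} ≤ |cdf μ x - cdf ν x| := by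
  obtain ⟨U, hU, hU01, hUt⟩ := hP.exists_uniform_Ioo
  have hiff : ∀ μ ω x, lowerQuantile μ (U ω) ≤ x ↔ U ω ≤ cdf μ x := fun μ ω x =>
    lowerQuantile_le_iff μ (hU01 ω) x
  have hset : ∀ μ x, MeasurableSet {ω | U ω ≤ cdf μ x} := fun μ x =>
    measurableSet_le hU measurable_const
  have hcdf : ∀ μ x, P.real {ω | U ω ≤ cdf μ x} = cdf μ x := fun μ x =>
    hUt _ (cdf_nonneg _ _) (cdf_le_one _ _)
  have hmeas : ∀ μ, Measurable fun ω => lowerQuantile μ (U ω) := by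
    refine fun μ => measurable_of_Iic fun x => ?_
    have : (fun ω => lowerQuantile μ (U ω)) ⁻¹' Set.Iic x = {ω | U ω ≤ cdf μ x} := by
      ext ω; exact hiff μ ω x
    rw [this]
    exact hset μ x
  refine ⟨fun μ ω => lowerQuantile μ (U ω), fun μ hμ => ⟨hmeas μ, ?_⟩, fun μ ν hμ hν x => ?_⟩
  · have := Measure.isProbabilityMeasure_map (μ := P) (hmeas μ).aemeasurable
    refine Measure.eq_of_cdf _ _ (StieltjesFunction.ext fun x => ?_)
    rw [cdf_eq_real, map_measureReal_apply (hmeas μ) measurableSet_Iic, ← hcdf μ x]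
    congr 1
    ext ω
    exact hiff μ ω x
  · have hs : {ω | lowerQuantile ν (U ω) ≤ x ∧ x < lowerQuantile μ (U ω)} =
        {ω | U ω ≤ cdf ν x} \ {ω | U ω ≤ cdf μ x} := by
      ext ω
      simp only [Set.mem_ofPred_eq, Set.mem_sdiff, hiff, ← not_le]
    rw [hs]
    -- Both events are sublevel sets of the same uniform variable, hence nested: the difference has
    -- measure (F_ν - F_μ)⁺.
    rcases le_total (cdf μ x) (cdf ν x) with h | h
    · have hsub : {ω | U ω ≤ cdf μ x} ⊆ {ω | U ω ≤ cdf ν x} := fun ω (hω : U ω ≤ _) => hω.trans h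
      rw [measureReal_sdiff hsub (hset μ x), hcdf, hcdf, abs_sub_comm]
      exact le_abs_self _
    · have : {ω | U ω ≤ cdf ν x} \ {ω | U ω ≤ cdf μ x} = ∅ :=
        Set.sdiff_eq_empty.2 fun ω (hω : U ω ≤ _) => hω.trans h
      rw [this, measureReal_empty]
      exact abs_nonneg _

end Coupling

/-! ### Polynomial tails and moments of the weighted laws. -/

section Moments

theorem phi_pos (l x : ℝ) : 0 < phi l x := by
  have : 0 ≤ |x| ^ l := Real.rpow_nonneg (abs_nonneg x) l
  unfold phi
  linarith

theorem abs_cdf_sub_mul_phi_le {l : ℝ} {μ ν : Measure ℝ} (h : dKolmogorov l μ ν < ∞) (x : ℝ) :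
    |cdf μ x - cdf ν x| * phi l x ≤ (dKolmogorov l μ ν).toReal :=
  (ENNReal.ofReal_le_iff_le_toReal h.ne).1
    (le_iSup (fun x => ENNReal.ofReal (|cdf μ x - cdf ν x| * phi l x)) x)

theorem dKolmogorov_comm (l : ℝ) (μ ν : Measure ℝ) : dKolmogorov l μ ν = dKolmogorov l ν μ := by
  simp only [dKolmogorov, abs_sub_comm]

theorem dKolmogorov_triangle (l : ℝ) (μ ν κ : Measure ℝ) :
    dKolmogorov l μ κ ≤ dKolmogorov l μ ν + dKolmogorov l ν κ := by
  refine iSup_le fun x => ?_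
  have hx := (phi_pos l x).le
  have h : |cdf μ x - cdf κ x| * phi l x ≤
      |cdf μ x - cdf ν x| * phi l x + |cdf ν x - cdf κ x| * phi l x := by
    rw [← add_mul]
    exact mul_le_mul_of_nonneg_right (abs_sub_le _ _ _) hx
  refine (ENNReal.ofReal_le_ofReal h).trans ?_
  rw [ENNReal.ofReal_add (by positivity) (by positivity)]
  exact add_le_add (le_iSup (fun x => ENNReal.ofReal (|cdf μ x - cdf ν x| * phi l x)) x)
    (le_iSup (fun x => ENNReal.ofReal (|cdf ν x - cdf κ x| * phi l x)) x)

theorem cdf_dirac_zero (x : ℝ) : cdf (Measure.dirac (0 : ℝ)) x = if 0 ≤ x then 1 else 0 := by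
  rw [cdf_eq_real, measureReal_def, Measure.dirac_apply' _ measurableSet_Iic]
  by_cases h : 0 ≤ x <;> simp [h]

/-- Laws at finite weighted distance from `δ₀` have polynomial tails. -/
theorem measure_abs_gt_le_of_mem_weightedLaws {l : ℝ} {μ : Measure ℝ} (hμ : μ ∈ weightedLaws l)
    {t : ℝ} (ht : 0 < t) :
    μ {x | t < |x|} ≤
      ENNReal.ofReal (2 * (dKolmogorov l μ (Measure.dirac 0)).toReal * t ^ (-l)) := by
  obtain ⟨hprob, hd⟩ := hμ
  set C := (dKolmogorov l μ (Measure.dirac 0)).toReal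
  have htl : 0 < t ^ l := Real.rpow_pos_of_pos ht l
  have aux : ∀ a : ℝ, 0 ≤ a → a * (1 + t ^ l) ≤ C → a ≤ C * t ^ (-l) := by
    intro a ha h
    rw [Real.rpow_neg ht.le, ← div_eq_mul_inv, le_div_iff₀ htl]
    nlinarith
  have h1 : 1 - cdf μ t ≤ C * t ^ (-l) := by
    have := abs_cdf_sub_mul_phi_le hd t
    rw [cdf_dirac_zero, if_pos ht.le, phi, abs_of_pos ht, abs_sub_comm,
      abs_of_nonneg (sub_nonneg.2 (cdf_le_one μ t))] at this
    exact aux _ (sub_nonneg.2 (cdf_le_one μ t)) this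
  have h2 : cdf μ (-t) ≤ C * t ^ (-l) := by
    have := abs_cdf_sub_mul_phi_le hd (-t)
    rw [cdf_dirac_zero, if_neg (by linarith), phi, abs_neg, abs_of_pos ht, sub_zero,
      abs_of_nonneg (cdf_nonneg μ _)] at this
    exact aux _ (cdf_nonneg μ _) this
  have hsub : {x : ℝ | t < |x|} ⊆ Set.Iic (-t) ∪ (Set.Iic t)ᶜ := by
    intro x hx
    rcases lt_abs.1 (show t < |x| from hx) with h | h
    · exact Or.inr (not_le.2 h)
    · exact Or.inl (show x ≤ -t by linarith)
  rw [← ENNReal.ofReal_toReal (measure_ne_top μ {x | t < |x|})]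
  refine ENNReal.ofReal_le_ofReal ?_
  have e1 : μ.real {x | t < |x|} ≤ μ.real (Set.Iic (-t)) + μ.real (Set.Iic t)ᶜ :=
    (measureReal_mono hsub).trans (measureReal_union_le _ _)
  rw [probReal_compl_eq_one_sub measurableSet_Iic, ← cdf_eq_real, ← cdf_eq_real] at e1
  exact e1.trans (by linarith)

/-- Layer-cake formula, split at 1: below, probabilities are at most 1 and r > 0; above, the tail
bound leaves t^(r-1-l), integrable as r < l. -/
theorem lintegral_abs_rpow_lt_top_of_mem_weightedLaws {l r : ℝ} {μ : Measure ℝ}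
    (hμ : μ ∈ weightedLaws l) (hr : 0 < r) (hrl : r < l) :
    ∫⁻ x, ENNReal.ofReal (|x| ^ r) ∂μ < ∞ := by
  have hprob := hμ.1
  rw [lintegral_rpow_eq_lintegral_meas_lt_mul μ (Eventually.of_forall fun x => abs_nonneg x)
    measurable_id.abs.aemeasurable hr]
  refine ENNReal.mul_lt_top ENNReal.ofReal_lt_top ?_
  rw [← Set.Ioc_union_Ioi_eq_Ioi (zero_le_one' ℝ)]
  refine (lintegral_union_le _ _ _).trans_lt (ENNReal.add_lt_top.2 ⟨?_, ?_⟩)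
  · have hint : IntegrableOn (fun t : ℝ => t ^ (r - 1)) (Set.Ioc 0 1) :=
      (intervalIntegrable_iff_integrableOn_Ioc_of_le zero_le_one).1
        (intervalIntegral.intervalIntegrable_rpow' (by linarith))
    refine lt_of_le_of_lt (setLIntegral_mono' measurableSet_Ioc fun t ht => ?_)
      (Integrable.lintegral_lt_top hint)
    exact mul_le_of_le_one_left' prob_le_one
  · set C := (dKolmogorov l μ (Measure.dirac 0)).toReal
    have hint : IntegrableOn (fun t : ℝ => 2 * C * t ^ (r - 1 - l)) (Set.Ioi 1) :=
      (integrableOn_Ioi_rpow_of_lt (by linarith) one_pos).const_mul _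
    refine lt_of_le_of_lt (setLIntegral_mono' measurableSet_Ioi fun t ht => ?_)
      (Integrable.lintegral_lt_top hint)
    have ht0 : (0 : ℝ) < t := one_pos.trans ht
    refine (mul_le_mul_left (measure_abs_gt_le_of_mem_weightedLaws hμ ht0) _).trans_eq ?_
    rw [← ENNReal.ofReal_mul (by positivity), mul_assoc, ← Real.rpow_add ht0]
    congr 3
    ring

theorem memLp_id_of_mem_weightedLaws {l r : ℝ} {μ : Measure ℝ}
    (hμ : μ ∈ weightedLaws l) (hr : 0 < r) (hrl : r < l) :
    MemLp (fun x : ℝ => x) (ENNReal.ofReal r) μ := by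
  refine ⟨measurable_id.aestronglyMeasurable, ?_⟩
  rw [eLpNorm_lt_top_iff_lintegral_rpow_enorm_lt_top (by simpa using hr) ENNReal.ofReal_ne_top,
    ENNReal.toReal_ofReal hr.le]
  refine lt_of_eq_of_lt ?_ (lintegral_abs_rpow_lt_top_of_mem_weightedLaws hμ hr hrl)
  refine lintegral_congr fun x => ?_
  rw [← ofReal_norm, ENNReal.ofReal_rpow_of_nonneg (norm_nonneg _) hr.le,
    Real.norm_eq_abs]

theorem memLp_of_map_mem_weightedLaws {Ω : Type*} [MeasurableSpace Ω] {P : Measure Ω} {l r : ℝ}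
    {X : Ω → ℝ} (hX : Measurable X) (h : P.map X ∈ weightedLaws l) (hr : 0 < r) (hrl : r < l) :
    MemLp X (ENNReal.ofReal r) P :=
  (memLp_map_measure_iff measurable_id.aestronglyMeasurable hX.aemeasurable).1
    (memLp_id_of_mem_weightedLaws h hr hrl)

theorem law_toLp {Ω : Type*} [MeasurableSpace Ω] {P : Measure Ω} {q : ℝ≥0∞} {X : Ω → ℝ}
    (hX : MemLp X q P) : law (hX.toLp X) = P.map X :=
  Measure.map_congr hX.coeFn_toLp

theorem weightedLaws_subset_lawsOf {Ω : Type*} [MeasurableSpace Ω] {P : Measure Ω}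
    [IsProbabilityMeasure P] (hP : IsAtomless P) {l r : ℝ} (hr : 0 < r) (hrl : r < l) :
    weightedLaws l ⊆ lawsOf P (ENNReal.ofReal r) := by
  intro μ hμ
  obtain ⟨Q, hQ, -⟩ := hP.exists_coupling
  obtain ⟨hm, hlaw⟩ := hQ μ hμ.1
  have hX := memLp_of_map_mem_weightedLaws hm (hlaw.symm ▸ hμ) hr hrl
  exact ⟨hX.toLp _, (law_toLp hX).trans hlaw⟩

end Moments

/-! ### Deterministic Riemann sums and level crossings. -/

section Grid

theorem sum_Ico_neg_natCast (h : ℤ → ℝ) (N : ℕ) :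
    ∑ i ∈ Finset.Ico (-(N : ℤ)) N, h i =
      ∑ k ∈ Finset.range N, (h k + h (-(k + 1 : ℤ))) := by
  induction N with
  | zero => simp
  | succ N ih =>
    have : Finset.Ico (-((N + 1 : ℕ) : ℤ)) ((N + 1 : ℕ) : ℤ) =
        insert (N : ℤ) (insert (-(N + 1 : ℤ)) (Finset.Ico (-(N : ℤ)) N)) := by
      ext i
      simp only [Finset.mem_Ico, Finset.mem_insert]
      push_cast
      omega
    rw [this, Finset.sum_insert (by simp; omega), Finset.sum_insert (by simp), ih,
      Finset.sum_range_succ]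
    ring

/-- Each block of M consecutive fine grid points lies to the right of an integer, whose value
dominates the block. -/
theorem sum_range_mul_le_of_antitone {f : ℝ → ℝ} (hf : AntitoneOn f (Set.Ici 0)) {M : ℕ}
    (hM : 0 < M) (K : ℕ) :
    ∑ k ∈ Finset.range (M * K), f (k * (1 / M)) ≤ M * ∑ j ∈ Finset.range K, f j := by
  have hM' : (0 : ℝ) < M := by exact_mod_cast hM
  induction K with
  | zero => simp
  | succ K ih =>
    rw [Nat.mul_succ, Finset.sum_range_add, Finset.sum_range_succ, mul_add]
    refine add_le_add ih ?_
    refine (Finset.sum_le_card_nsmul (Finset.range M) _ (f K) fun r _ => ?_).trans_eq (by simp)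
    refine hf (Set.mem_Ici.2 (by positivity)) (Set.mem_Ici.2 (by positivity)) ?_
    push_cast
    rw [add_mul, mul_one_div, mul_div_cancel_left₀ _ hM'.ne']
    exact le_add_of_nonneg_right (by positivity)

theorem antitoneOn_phi_rpow_neg {l β : ℝ} (hl : 0 ≤ l) (hβ : 0 ≤ β) :
    AntitoneOn (fun x => phi l x ^ (-β)) (Set.Ici 0) := by
  intro x hx y hy hxy
  refine Real.rpow_le_rpow_of_nonpos (phi_pos l x) ?_ (neg_nonpos.2 hβ)
  unfold phi
  rw [abs_of_nonneg hx, abs_of_nonneg hy]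
  linarith [Real.rpow_le_rpow hx hxy hl]

theorem summable_phi_rpow_neg {l β : ℝ} (hβ : 0 < β) (hlβ : 1 < l * β) :
    Summable fun j : ℕ => phi l j ^ (-β) := by
  -- The comparison with j^(-lβ) fails at j = 0, which is dropped.
  refine (summable_nat_add_iff 1).1 ?_
  have hs : Summable fun j : ℕ => (((j + 1 : ℕ) : ℝ)) ^ (-(l * β)) :=
    (summable_nat_add_iff 1).2 (Real.summable_nat_rpow.2 (by linarith))
  refine Summable.of_nonneg_of_le (fun j => Real.rpow_nonneg (phi_pos _ _).le _) (fun j => ?_) hs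
  have hj : (0 : ℝ) < ((j + 1 : ℕ) : ℝ) := by positivity
  rw [show -(l * β) = l * -β by ring, Real.rpow_mul hj.le]
  refine Real.rpow_le_rpow_of_nonpos (Real.rpow_pos_of_pos hj l) ?_ (by linarith)
  unfold phi
  rw [abs_of_pos hj]
  linarith

/-- The bound must not depend on M or K, as the mesh is later refined. Evenness of the weight folds
the negative half onto the positive one. -/
theorem sum_grid_phi_rpow_neg_le {l β : ℝ} (hl : 0 ≤ l) (hβ : 0 < β) (hlβ : 1 < l * β) {M : ℕ}
    (hM : 0 < M) (K : ℕ) :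
    ∑ i ∈ Finset.Ico (-((M * K : ℕ) : ℤ)) ((M * K : ℕ) : ℤ),
      (1 / M : ℝ) * phi l (i * (1 / M)) ^ (-β) ≤ 2 * ∑' j : ℕ, phi l j ^ (-β) := by
  have hanti := antitoneOn_phi_rpow_neg hl hβ.le
  have hM' : (0 : ℝ) < M := by exact_mod_cast hM
  have hneg : ∀ x, phi l (-x) = phi l x := fun x => by simp [phi]
  have hterm : ∀ k : ℕ, phi l (((-(k + 1 : ℤ) : ℤ) : ℝ) * (1 / M)) ^ (-β) ≤
      phi l (k * (1 / M)) ^ (-β) := by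
    intro k
    rw [show (((-(k + 1 : ℤ) : ℤ) : ℝ) * (1 / M)) = -((k + 1) * (1 / M)) by push_cast; ring, hneg]
    refine hanti (Set.mem_Ici.2 (by positivity)) (Set.mem_Ici.2 (by positivity)) ?_
    gcongr
    linarith
  rw [← Finset.mul_sum, sum_Ico_neg_natCast]
  have h1 : ∑ k ∈ Finset.range (M * K), (phi l (((k : ℤ) : ℝ) * (1 / M)) ^ (-β) +
      phi l (((-(k + 1 : ℤ) : ℤ) : ℝ) * (1 / M)) ^ (-β)) ≤
      2 * ∑ k ∈ Finset.range (M * K), phi l (k * (1 / M)) ^ (-β) := by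
    rw [Finset.mul_sum]
    refine Finset.sum_le_sum fun k _ => ?_
    have := hterm k
    rw [Int.cast_natCast]
    linarith
  have h2 := sum_range_mul_le_of_antitone hanti hM K
  have h3 := (summable_phi_rpow_neg hβ hlβ).sum_le_tsum (Finset.range K)
    (fun j _ => Real.rpow_nonneg (phi_pos _ _).le _)
  rw [one_div, inv_mul_le_iff₀ hM']
  rw [one_div] at h1 h2
  nlinarith

/-- The length of an interval is controlled by the number of grid points it contains. -/
theorem sub_le_add_sum_grid {a b δ : ℝ} (hδ : 0 < δ) (N : ℕ) (ha : -(N * δ) ≤ a)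
    (hb : b ≤ N * δ) (hab : a ≤ b) :
    b - a ≤ δ + ∑ i ∈ Finset.Ico (-(N : ℤ)) N,
      δ * (if a ≤ i * δ ∧ i * δ < b then 1 else 0) := by
  -- These indices are grid points in [a, b); there are more than (b - a) / δ - 1 of them.
  have hsub : Finset.Ico ⌈a / δ⌉ ⌈b / δ⌉ ⊆
      (Finset.Ico (-(N : ℤ)) N).filter (fun i : ℤ => a ≤ i * δ ∧ i * δ < b) := by
    intro i hi
    obtain ⟨h1, h2⟩ := Finset.mem_Ico.1 hi
    have h1' := (div_le_iff₀ hδ).1 (Int.ceil_le.1 h1)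
    have h2' := (lt_div_iff₀ hδ).1 (Int.lt_ceil.1 h2)
    refine Finset.mem_filter.2 ⟨Finset.mem_Ico.2 ⟨?_, ?_⟩, h1', h2'⟩
    · refine le_trans (Int.le_of_lt_add_one ?_) h1
      have h3 : ((-(N : ℤ) : ℤ) : ℝ) ≤ a / δ := by
        rw [le_div_iff₀ hδ]; push_cast; linarith
      have : ((-(N : ℤ) : ℤ) : ℝ) < ((⌈a / δ⌉ + 1 : ℤ) : ℝ) := by
        push_cast at h3 ⊢; linarith [Int.le_ceil (a / δ)]
      exact_mod_cast this
    · have h3 : (i : ℝ) * δ < ((N : ℤ) : ℝ) * δ := by push_cast; linarith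
      exact_mod_cast lt_of_mul_lt_mul_right h3 hδ.le
  have hcard := Finset.card_le_card hsub
  rw [Int.card_Ico] at hcard
  have hle : ⌈a / δ⌉ ≤ ⌈b / δ⌉ := Int.ceil_mono (by gcongr)
  have hcard' : ((⌈b / δ⌉ - ⌈a / δ⌉ : ℤ) : ℝ) ≤
      (((Finset.Ico (-(N : ℤ)) N).filter (fun i : ℤ => a ≤ i * δ ∧ i * δ < b)).card : ℝ) := by
    have : ⌈b / δ⌉ - ⌈a / δ⌉ ≤
      (((Finset.Ico (-(N : ℤ)) N).filter (fun i : ℤ => a ≤ i * δ ∧ i * δ < b)).card : ℤ) := by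
      omega
    exact_mod_cast this
  rw [← Finset.mul_sum, Finset.sum_boole]
  push_cast at hcard'
  have h4 : b / δ - a / δ - 1 ≤
      (((Finset.Ico (-(N : ℤ)) N).filter (fun i : ℤ => a ≤ i * δ ∧ i * δ < b)).card : ℝ) := by
    linarith [Int.le_ceil (b / δ), Int.ceil_lt_add_one (a / δ)]
  have h5 := mul_le_mul_of_nonneg_left h4 hδ.le
  have h6 : δ * (b / δ - a / δ - 1) = b - a - δ := by field_simp
  linarith

theorem abs_le_rpow_mul_of_le {x K r : ℝ} (hK : 0 < K) (hr : 1 ≤ r) (hx : K ≤ |x|) :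
    |x| ≤ K ^ (1 - r) * |x| ^ r := by
  have hx0 : 0 < |x| := hK.trans_le hx
  calc |x| = |x| ^ (1 - r) * |x| ^ r := by
        rw [← Real.rpow_add hx0]; simp
    _ ≤ K ^ (1 - r) * |x| ^ r := by
        gcongr ?_ * _
        exact Real.rpow_le_rpow_of_nonpos hK hx (by linarith)

/-- A difference is controlled by crossings of the grid levels and by superlinear tails. -/
theorem sub_le_add_sum_crossing (x y : ℝ) {δ r : ℝ} (hδ : 0 < δ) (hr : 1 ≤ r) {N : ℕ}
    (hN : 0 < N) :
    x - y ≤ δ + ∑ i ∈ Finset.Ico (-(N : ℤ)) N, δ * (if y ≤ i * δ ∧ i * δ < x then 1 else 0) +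
      (N * δ) ^ (1 - r) * (|x| ^ r + |y| ^ r) := by
  set K : ℝ := N * δ with hK
  have hK0 : 0 < K := by have : (0 : ℝ) < N := by exact_mod_cast hN
                         positivity
  have hx0 : 0 ≤ K ^ (1 - r) * |x| ^ r := by positivity
  have hy0 : 0 ≤ K ^ (1 - r) * |y| ^ r := by positivity
  -- Truncate both points to [-K, K]: the grid handles the truncated interval, the r-th powers pay
  -- for the rest.
  set a := max (-K) y with ha
  set b := min K x with hb
  have hxb : x - b ≤ K ^ (1 - r) * |x| ^ r := by
    rcases le_total x K with h | h
    · rw [hb, min_eq_right h]; linarith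
    · have := abs_le_rpow_mul_of_le hK0 hr (h.trans (le_abs_self x))
      rw [hb, min_eq_left h]; linarith [le_abs_self x]
  have hya : a - y ≤ K ^ (1 - r) * |y| ^ r := by
    rcases le_total (-K) y with h | h
    · rw [ha, max_eq_right h]; linarith
    · have h' : K ≤ |y| := by linarith [neg_abs_le y]
      have := abs_le_rpow_mul_of_le hK0 hr h'
      rw [ha, max_eq_left h]; linarith [neg_abs_le y]
  have hsum0 : 0 ≤ ∑ i ∈ Finset.Ico (-(N : ℤ)) N,
      δ * (if y ≤ i * δ ∧ i * δ < x then (1 : ℝ) else 0) :=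
    Finset.sum_nonneg fun i _ => by split_ifs <;> simp [hδ.le]
  have hba : b - a ≤ δ + ∑ i ∈ Finset.Ico (-(N : ℤ)) N,
      δ * (if y ≤ i * δ ∧ i * δ < x then 1 else 0) := by
    rcases le_total a b with h | h
    · refine (sub_le_add_sum_grid hδ N (le_max_left _ _) (min_le_left _ _) h).trans ?_
      gcongr with i hi
      by_cases hi' : a ≤ i * δ ∧ i * δ < b
      · rw [if_pos hi', if_pos ⟨(le_max_right _ _).trans hi'.1, hi'.2.trans_le (min_le_right _ _)⟩]
      · rw [if_neg hi']; split_ifs <;> simp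
    · linarith
  rw [mul_add]
  linarith

end Grid

/-! ### From pointwise bounds to the risk measure. -/

section Coherent

variable {Ω : Type*} [MeasurableSpace Ω] {P : Measure Ω} {q : ℝ≥0∞} [IsProbabilityMeasure P]
  {ρ : Lp ℝ q P → ℝ}

theorem IsCoherent.map_zero (h : IsCoherent ρ) : ρ 0 = 0 := by
  simpa using h.posHomogeneous 0 0 le_rfl

theorem IsCoherent.map_const (h : IsCoherent ρ) (m : ℝ) : ρ (Lp.const q P m) = m := by
  simpa [h.map_zero] using h.cashAdditive 0 m

theorem IsCoherent.map_sum_le (h : IsCoherent ρ) {ι : Type*} (s : Finset ι) (X : ι → Lp ℝ q P) :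
    ρ (∑ i ∈ s, X i) ≤ ∑ i ∈ s, ρ (X i) := by
  classical
  induction s using Finset.induction_on with
  | empty => simp [h.map_zero]
  | insert i s hi ih =>
    rw [Finset.sum_insert hi, Finset.sum_insert hi]
    exact (h.subadditive _ _).trans (by gcongr)

theorem law_indicatorConstLp {A : Set Ω} (hA : MeasurableSet A) (t : I)
    (ht : (t : ℝ) = P.real A) :
    law (indicatorConstLp q hA (measure_ne_top P A) (1 : ℝ)) = bernoulliMeasure (1 : ℝ) 0 t := by
  classical
  have h1 : ((unitInterval.toNNReal t : NNReal) : ℝ≥0∞) = P A := by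
    rw [← ENNReal.toReal_eq_toReal_iff' ENNReal.coe_ne_top (measure_ne_top P A)]
    simpa [measureReal_def] using ht
  have h2 : ((unitInterval.toNNReal (unitInterval.symm t) : NNReal) : ℝ≥0∞) = P Aᶜ := by
    rw [← ENNReal.toReal_eq_toReal_iff' ENNReal.coe_ne_top (measure_ne_top P _)]
    have := probReal_compl_eq_one_sub (μ := P) hA
    rw [← ht] at this
    simpa [measureReal_def] using this.symm
  rw [law, Measure.map_congr indicatorConstLp_coeFn]
  have hm : Measurable (A.indicator fun _ => (1 : ℝ)) := measurable_const.indicator hA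
  ext s hs
  rw [Measure.map_apply hm hs, bernoulliMeasure_apply t hs, h1, h2]
  rw [Set.indicator_const_preimage_eq_union]
  by_cases h1s : (1 : ℝ) ∈ s <;> by_cases h0s : (0 : ℝ) ∈ s <;> simp [h1s, h0s]

/-- An indicator is a Bernoulli variable, so this is the hypothesis on g at 1 - P(A). -/
theorem map_indicatorConstLp_le (hlaw : IsLawInvariant ρ) {L β : ℝ}
    (hg : ∀ t : I, 1 - gFun ρ t ≤ L * (1 - (t : ℝ)) ^ β) {A : Set Ω} (hA : MeasurableSet A) :
    ρ (indicatorConstLp q hA (measure_ne_top P A) (1 : ℝ)) ≤ L * P.real A ^ β := by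
  let t : I := ⟨P.real A, measureReal_nonneg, measureReal_le_one⟩
  have h := hg (unitInterval.symm t)
  rw [gFun, unitInterval.symm_symm, ← law_indicatorConstLp (q := q) hA t rfl,
    riskFunctional_law hlaw] at h
  simpa [t] using h

/-- Monotonicity carries the grid inequality over to ρ, subadditivity and homogeneity split it, and
each crossing event costs at most L (D / φ)^β. -/
theorem IsCoherent.sub_le_of_crossing (hcoh : IsCoherent ρ) (hlaw : IsLawInvariant ρ) {L β : ℝ}
    (hL : 0 ≤ L) (hβ : 0 < β) (hg : ∀ t : I, 1 - gFun ρ t ≤ L * (1 - (t : ℝ)) ^ β)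
    {l r D : ℝ} (hl : 0 ≤ l) (hlβ : 1 < l * β) (hr : 1 < r) {X Y : Ω → ℝ} (hXm : Measurable X)
    (hYm : Measurable Y) (hX : MemLp X q P) (hY : MemLp Y q P)
    (hXr : MemLp (fun ω => |X ω| ^ r) q P) (hYr : MemLp (fun ω => |Y ω| ^ r) q P)
    (hcross : ∀ x, P.real {ω | Y ω ≤ x ∧ x < X ω} * phi l x ≤ D) :
    ρ (hX.toLp X) - ρ (hY.toLp Y) ≤ L * (2 * ∑' j : ℕ, phi l j ^ (-β)) * D ^ β := by
  have hA : ∀ x : ℝ, MeasurableSet {ω | Y ω ≤ x ∧ x < X ω} := fun x =>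
    (measurableSet_le hYm measurable_const).inter (measurableSet_lt measurable_const hXm)
  have hD : 0 ≤ D := le_trans (mul_nonneg measureReal_nonneg (phi_pos l 0).le) (hcross 0)
  set W : Lp ℝ q P := (hXr.add hYr).toLp _ with hW
  let B : ℝ → Lp ℝ q P := fun x => indicatorConstLp q (hA x) (measure_ne_top P _) 1
  have hB : ∀ x, ρ (B x) ≤ L * (D ^ β * phi l x ^ (-β)) := by
    intro x
    refine (map_indicatorConstLp_le hlaw hg (hA x)).trans (mul_le_mul_of_nonneg_left ?_ hL)
    have hp := phi_pos l x
    rw [Real.rpow_neg hp.le, ← div_eq_mul_inv, ← Real.div_rpow hD hp.le]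
    exact Real.rpow_le_rpow measureReal_nonneg ((le_div_iff₀ hp).2 (hcross x)) hβ.le
  have key : ∀ M : ℕ, 0 < M → ρ (hX.toLp X) - ρ (hY.toLp Y) ≤
      1 / M + L * (2 * ∑' j : ℕ, phi l j ^ (-β)) * D ^ β + (M : ℝ) ^ (1 - r) * ρ W := by
    intro M hM
    have hM' : (0 : ℝ) < M := by exact_mod_cast hM
    set δ : ℝ := 1 / M with hδ
    have hδ0 : 0 < δ := by positivity
    -- With mesh 1/M, M² points on each side make the grid span [-M, M].
    set s := Finset.Ico (-((M * M : ℕ) : ℤ)) ((M * M : ℕ) : ℤ) with hs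
    have hNδ : ((M * M : ℕ) : ℝ) * δ = M := by push_cast; rw [hδ]; field_simp
    have hle : hX.toLp X ≤ (Lp.const q P δ + ∑ i ∈ s, δ • B (i * δ)) +
        (M : ℝ) ^ (1 - r) • W + hY.toLp Y := by
      rw [← Lp.coeFn_le]
      have hBae : ∀ᵐ ω ∂P, ∀ i : ℤ, (δ • B (i * δ) : Lp ℝ q P) ω =
          δ * (if Y ω ≤ i * δ ∧ i * δ < X ω then 1 else 0) := by
        rw [ae_all_iff]
        intro i
        filter_upwards [Lp.coeFn_smul δ (B (i * δ)), indicatorConstLp_coeFn (p := q)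
          (hs := hA (i * δ)) (hμs := measure_ne_top P _) (c := (1 : ℝ))] with ω h1 h2
        rw [h1, Pi.smul_apply, smul_eq_mul, h2, Set.indicator_apply]
        rfl
      filter_upwards [hX.coeFn_toLp, hY.coeFn_toLp, (hXr.add hYr).coeFn_toLp,
        Lp.coeFn_const q P δ, Lp.coeFn_smul ((M : ℝ) ^ (1 - r)) W, hBae,
        Lp.coeFn_finsetSum s (fun i : ℤ => δ • B (i * δ)),
        Lp.coeFn_add (Lp.const q P δ) (∑ i ∈ s, δ • B (i * δ)),
        Lp.coeFn_add (Lp.const q P δ + ∑ i ∈ s, δ • B (i * δ)) ((M : ℝ) ^ (1 - r) • W),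
        Lp.coeFn_add (Lp.const q P δ + ∑ i ∈ s, δ • B (i * δ) + (M : ℝ) ^ (1 - r) • W)
          (hY.toLp Y)] with ω e1 e2 e3 e4 e5 e6 e7 e8 e9 e10
      rw [e10, Pi.add_apply, e9, Pi.add_apply, e8, Pi.add_apply, e7, e5, Pi.smul_apply, e4, hW,
        e3, e2, e1, Finset.sum_apply, Finset.sum_congr rfl fun i _ => e6 i]
      have := sub_le_add_sum_crossing (X ω) (Y ω) hδ0 hr.le (Nat.mul_pos hM hM)
      rw [hNδ] at this
      simp only [Function.const_apply, smul_eq_mul, Pi.add_apply]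
      linarith
    have h1 := hcoh.monotone _ _ hle
    have h2 := hcoh.subadditive (Lp.const q P δ + ∑ i ∈ s, δ • B (i * δ) + (M : ℝ) ^ (1 - r) • W)
      (hY.toLp Y)
    have h3 := hcoh.subadditive (Lp.const q P δ + ∑ i ∈ s, δ • B (i * δ)) ((M : ℝ) ^ (1 - r) • W)
    have h4 := hcoh.subadditive (Lp.const q P δ) (∑ i ∈ s, δ • B (i * δ))
    rw [hcoh.map_const] at h4
    rw [hcoh.posHomogeneous _ _ (by positivity : (0 : ℝ) ≤ (M : ℝ) ^ (1 - r))] at h3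
    have h5 : ρ (∑ i ∈ s, δ • B (i * δ)) ≤ L * (2 * ∑' j : ℕ, phi l j ^ (-β)) * D ^ β := by
      calc ρ (∑ i ∈ s, δ • B (i * δ)) ≤ ∑ i ∈ s, ρ (δ • B (i * δ)) := hcoh.map_sum_le _ _
        _ ≤ ∑ i ∈ s, L * D ^ β * (δ * phi l (i * δ) ^ (-β)) := by
          refine Finset.sum_le_sum fun i _ => ?_
          rw [hcoh.posHomogeneous _ _ hδ0.le]
          refine (mul_le_mul_of_nonneg_left (hB _) hδ0.le).trans_eq (by ring)
        _ = L * D ^ β * ∑ i ∈ s, δ * phi l (i * δ) ^ (-β) := by rw [Finset.mul_sum]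
        _ ≤ L * D ^ β * (2 * ∑' j : ℕ, phi l j ^ (-β)) :=
          mul_le_mul_of_nonneg_left (sum_grid_phi_rpow_neg_le hl hβ hlβ hM M) (by positivity)
        _ = _ := by ring
    linarith
  have hlim1 : Tendsto (fun n : ℕ => 1 / ((n + 1 : ℕ) : ℝ)) atTop (𝓝 0) := by
    simpa using tendsto_one_div_add_atTop_nhds_zero_nat (𝕜 := ℝ)
  have hlim2 : Tendsto (fun n : ℕ => ((n + 1 : ℕ) : ℝ) ^ (1 - r)) atTop (𝓝 0) := by
    have h := (tendsto_rpow_neg_atTop (sub_pos.2 hr)).comp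
      (tendsto_natCast_atTop_atTop.comp (tendsto_add_atTop_nat 1))
    simpa [Function.comp_def, neg_sub] using h
  have hlim := (hlim1.add_const (L * (2 * ∑' j : ℕ, phi l j ^ (-β)) * D ^ β)).add
    (hlim2.mul_const (ρ W))
  rw [zero_add, zero_mul, add_zero] at hlim
  exact ge_of_tendsto' hlim fun n => key (n + 1) n.succ_pos

end Coherent

/-- Hölder continuity of the risk functional with respect to the weighted Kolmogorov distance. -/
theorem IsCoherent.abs_riskFunctional_sub_le {Ω : Type*} [MeasurableSpace Ω] {P : Measure Ω}
    [IsProbabilityMeasure P] (hP : IsAtomless P) {p : ℝ} (hp : 0 < p)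
    {ρ : Lp ℝ (ENNReal.ofReal p) P → ℝ} (hcoh : IsCoherent ρ) (hlaw : IsLawInvariant ρ)
    {L β : ℝ} (hL : 0 ≤ L) (hβ : 0 < β) (hg : ∀ t : I, 1 - gFun ρ t ≤ L * (1 - (t : ℝ)) ^ β)
    {l : ℝ} (hpl : p < l) (hlβ : 1 < l * β) {μ ν : Measure ℝ} (hμ : μ ∈ weightedLaws l)
    (hν : ν ∈ weightedLaws l) :
    |riskFunctional ρ μ - riskFunctional ρ ν| ≤
      L * (2 * ∑' j : ℕ, phi l j ^ (-β)) * (dKolmogorov l μ ν).toReal ^ β := by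
  obtain ⟨Q, hQ, hcross⟩ := hP.exists_coupling
  -- Moments of order s < l exist, so the power r = s / p > 1 of each representative stays in L^p.
  set s := (p + l) / 2 with hs
  have hps : p < s := by linarith
  have hs0 : 0 < s := hp.trans hps
  have hr : 1 < s / p := (one_lt_div hp).2 hps
  have hmem : ∀ κ ∈ weightedLaws l, MemLp (Q κ) (ENNReal.ofReal p) P := fun κ hκ =>
    memLp_of_map_mem_weightedLaws (hQ κ hκ.1).1 ((hQ κ hκ.1).2.symm ▸ hκ) hp hpl
  have hmemr : ∀ κ ∈ weightedLaws l,
      MemLp (fun ω => |Q κ ω| ^ (s / p)) (ENNReal.ofReal p) P := by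
    intro κ hκ
    have h := (memLp_of_map_mem_weightedLaws (hQ κ hκ.1).1 ((hQ κ hκ.1).2.symm ▸ hκ) hs0
      (show s < l by linarith)).norm_rpow_div (ENNReal.ofReal (s / p))
    rw [← ENNReal.ofReal_div_of_pos (by positivity), ENNReal.toReal_ofReal (by positivity),
      div_div_cancel₀ hs0.ne'] at h
    exact h
  have hrisk : ∀ κ (hκ : κ ∈ weightedLaws l),
      riskFunctional ρ κ = ρ ((hmem κ hκ).toLp (Q κ)) := fun κ hκ => by
    rw [← riskFunctional_law hlaw, law_toLp, (hQ κ hκ.1).2]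
  have hone : ∀ κ κ' (hκ : κ ∈ weightedLaws l) (hκ' : κ' ∈ weightedLaws l),
      riskFunctional ρ κ - riskFunctional ρ κ' ≤
        L * (2 * ∑' j : ℕ, phi l j ^ (-β)) * (dKolmogorov l κ κ').toReal ^ β := by
    intro κ κ' hκ hκ'
    have hd : dKolmogorov l κ κ' < ∞ := (dKolmogorov_triangle l κ (Measure.dirac 0) κ').trans_lt
      (ENNReal.add_lt_top.2 ⟨hκ.2, by rw [dKolmogorov_comm]; exact hκ'.2⟩)
    rw [hrisk κ hκ, hrisk κ' hκ']
    exact hcoh.sub_le_of_crossing hlaw hL hβ hg (hp.trans hpl).le hlβ hr (hQ κ hκ.1).1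
      (hQ κ' hκ'.1).1 (hmem κ hκ) (hmem κ' hκ') (hmemr κ hκ) (hmemr κ' hκ') fun x =>
        (mul_le_mul_of_nonneg_right (hcross κ κ' hκ.1 hκ'.1 x) (phi_pos l x).le).trans
          (abs_cdf_sub_mul_phi_le hd x)
  refine abs_sub_le_iff.2 ⟨hone μ ν hμ hν, ?_⟩
  rw [dKolmogorov_comm]
  exact hone ν μ hν hμ

end RiskMeasure

theorem mainTheorem3 {Ω : Type*} [MeasurableSpace Ω] (P : Measure Ω) [IsProbabilityMeasure P]
    (hP : RiskMeasure.IsAtomless P) (p : ℝ) (hp : 1 ≤ p)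
    (ρ : Lp ℝ (ENNReal.ofReal p) P → ℝ)
    (hcoh : RiskMeasure.IsCoherent ρ) (hlaw : RiskMeasure.IsLawInvariant ρ)
    (L β : ℝ) (hL : 0 < L) (hβ : 0 < β)
    (hg : ∀ t : I, 1 - RiskMeasure.gFun ρ t ≤ L * (1 - (t : ℝ)) ^ β) :
    ∀ l : ℝ, p < l → 1 < l * β →
      RiskMeasure.ConditionC ρ l ∧ RiskMeasure.ConditionD ρ l β := by
  intro l hpl hlβ
  have hp0 : 0 < p := one_pos.trans_le hp
  refine ⟨⟨hcoh.cashAdditive, hcoh.posHomogeneous,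
    RiskMeasure.weightedLaws_subset_lawsOf hP hp0 hpl⟩, fun m hm hlim => ?_⟩
  -- No Gaussian tail estimate is needed: some term of the sequence is at finite distance from both
  -- the normal law and δ₀.
  have hN : gaussianReal 0 1 ∈ RiskMeasure.weightedLaws l := by
    obtain ⟨n, hn⟩ := (hlim.eventually_lt_const ENNReal.zero_lt_top).exists
    refine ⟨inferInstance, (RiskMeasure.dKolmogorov_triangle l _ (m n) _).trans_lt ?_⟩
    rw [RiskMeasure.dKolmogorov_comm l _ (m n)]
    exact ENNReal.add_lt_top.2 ⟨hn, (hm n).2⟩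
  have hS : 0 ≤ ∑' j : ℕ, RiskMeasure.phi l j ^ (-β) :=
    tsum_nonneg fun j => Real.rpow_nonneg (RiskMeasure.phi_pos l j).le _
  -- The added 1 makes the constant positive when the series is only known to be nonnegative.
  refine ⟨L * (2 * ∑' j : ℕ, RiskMeasure.phi l j ^ (-β)) + 1, by positivity, fun n => ?_⟩
  refine (hcoh.abs_riskFunctional_sub_le hP hp0 hlaw hL.le hβ hg hpl hlβ (hm n) hN).trans ?_
  gcongr
  linarith
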